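/- For an integer $n\ge 4$, let $\mathrm{SD}_{2^n}=\langle \sigma,\tau \mid \sigma^{2^{n-1}}=\tau^2=1,\ \tau^{-1}\sigma\tau=\sigma^{2^{n-2}-1}\rangle$ be the semidihedral group of order $2^n$. For a finite group $G$ with conjugacy classes $K_1,\dots,K_s$ and complex irreducible characters $\chi_1,\dots,\chi_s$, let Harada's number of $G$ be $$h(G)=\frac{|K_1|\cdots|K_s|}{\chi_1(1)\cdots\chi_s(1)}.$$ Then for every integer $n\ge 4$, with $G=\mathrm{SD}_{2^n}$ and $G'$ its commutator subgroup, $$h(G)=2^{2(n-2)}=|G'|^2 .$$ -/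

import Mathlib

/-- The complex irreducible characters of a group `G`, as functions `G → ℂ`: the characters of the
irreducible finite-dimensional complex representations of `G`. Every such representation is
isomorphic to one on some `ℂ ^ d`, and isomorphic representations have the same character. -/
def irreducibleCharacters (G : Type*) [Group G] : Set (G → ℂ) :=
  {χ | ∃ (d : ℕ) (ρ : Representation ℂ G (Fin d → ℂ)), ρ.IsIrreducible ∧ χ = ρ.character}

/-- Harada's number of a finite group `G`: the product of the sizes of all conjugacy classes of `G`
divided by the product of the degrees `χ(1)` of all complex irreducible characters of `G`. Both
products are over finite index sets when `G` is finite. -/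
noncomputable def haradaNumber (G : Type*) [Group G] : ℂ :=
  (∏ᶠ K : ConjClasses G, (Nat.card K.carrier : ℂ)) / ∏ᶠ χ ∈ irreducibleCharacters G, χ 1

namespace SemidihedralGroup

/-- The two generators. -/
inductive Gen : Type
  | σ
  | τ

/-- The generator `σ` in the free group. -/
def s : FreeGroup Gen := FreeGroup.of Gen.σ

/-- The generator `τ` in the free group. -/
def t : FreeGroup Gen := FreeGroup.of Gen.τ

/-- The relators of `σ ^ (2 ^ (n - 1)) = 1`, `τ ^ 2 = 1` and
`τ⁻¹ * σ * τ = σ ^ (2 ^ (n - 2) - 1)`. -/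
def rels (n : ℕ) : Set (FreeGroup Gen) :=
  {s ^ (2 ^ (n - 1)), t ^ 2, (t⁻¹ * s * t) * (s ^ (2 ^ (n - 2) - 1))⁻¹}

end SemidihedralGroup

/-- The semidihedral group of order `2 ^ n` (for `4 ≤ n`), by generators and relations. -/
abbrev SemidihedralGroup (n : ℕ) : Type :=
  PresentedGroup (SemidihedralGroup.rels n)

/-! Write `n = 4 + b` and `a = 2 ^ b`, so that `s` has order `8a` and `t` acts on exponents by
multiplication by `4a - 1`, an involution mod `8a`. Central classes have size 1. Noncentral classes
inside `⟨s⟩` have size 2 and correspond to the two-element orbits of that involution. The elements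
outside `⟨s⟩` form two classes of size `4a`. Irreducible characters have degree 1 or 2, and those of
degree 2 are indexed by the same two-element orbits (`exists_matrixChar_eq`, `matrixChar_eq_iff`).

Hence the powers of 2 in numerator and denominator cancel without being counted, leaving `(4a) ^ 2`.
The commutator subgroup consists of the even powers of `s` and has order `4a`. -/

/-- The elements `s` and `t` generate `G`, satisfy the semidihedral relations of order `16 * a`, and
`G` is universal among groups with such a pair of elements. -/
structure IsSemidihedralPair (a : ℕ) {G : Type} [Group G] (s t : G) : Prop where
  pow_s : s ^ (8 * a : ℤ) = 1
  sq_t : t ^ 2 = 1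
  conj_s : t⁻¹ * s * t = s ^ (4 * a - 1 : ℤ)
  mem_of_mem : ∀ H : Subgroup G, s ∈ H → t ∈ H → ∀ g, g ∈ H
  exists_lift : ∀ {M : Type} [Group M] (x y : M), x ^ (8 * a : ℤ) = 1 → y ^ 2 = 1 →
    y⁻¹ * x * y = x ^ (4 * a - 1 : ℤ) → ∃ f : G →* M, f s = x ∧ f t = y

theorem dvd_sq_sub_one (a : ℤ) : 8 * a ∣ (4 * a - 1) * (4 * a - 1) - 1 :=
  ⟨2 * a - 1, by ring⟩

/-- Invertible diagonal `2 × 2` matrices. -/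
def diagonalUnits : ℂˣ × ℂˣ →* (Matrix (Fin 2) (Fin 2) ℂ)ˣ where
  toFun p := ⟨!![(p.1 : ℂ), 0; 0, p.2], !![((p.1⁻¹ : ℂˣ) : ℂ), 0; 0, (p.2⁻¹ : ℂˣ)],
    by simp [Matrix.one_fin_two], by simp [Matrix.one_fin_two]⟩
  map_one' := by ext1; simp [Matrix.one_fin_two]
  map_mul' p q := by ext1; simp

/-- The `2 × 2` matrix swapping the coordinates. -/
def swapUnit : (Matrix (Fin 2) (Fin 2) ℂ)ˣ :=
  ⟨!![0, 1; 1, 0], !![0, 1; 1, 0], by simp [Matrix.one_fin_two], by simp [Matrix.one_fin_two]⟩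

theorem swapUnit_conj (p : ℂˣ × ℂˣ) :
    swapUnit⁻¹ * diagonalUnits p * swapUnit = diagonalUnits (p.2, p.1) := by
  ext1
  simp [swapUnit, diagonalUnits]

theorem Subrepresentation.isSimpleOrder_of {G V : Type*} [Group G] [AddCommGroup V] [Module ℂ V]
    [Nontrivial V] {ρ : Representation ℂ G V}
    (h : ∀ W : Submodule ℂ V, (∀ g, ∀ v ∈ W, ρ g v ∈ W) → W ≠ ⊥ → W = ⊤) :
    ρ.IsIrreducible where
  exists_pair_ne := ⟨⊥, ⊤, fun e => bot_ne_top (α := Submodule ℂ V)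
    (congrArg Subrepresentation.toSubmodule e)⟩
  eq_bot_or_eq_top W := by
    by_cases hW : W.toSubmodule = ⊥
    · exact Or.inl (Subrepresentation.toSubmodule_injective hW)
    · exact Or.inr (Subrepresentation.toSubmodule_injective
        (h _ (fun g v hv => W.apply_mem_toSubmodule g hv) hW))

theorem Representation.IsIrreducible.nontrivial {G V : Type*} [Group G] [AddCommGroup V]
    [Module ℂ V] {ρ : Representation ℂ G V} (h : ρ.IsIrreducible) : Nontrivial V := by
  by_contra hV
  rw [not_nontrivial_iff_subsingleton] at hV
  obtain ⟨x, y, hxy⟩ := h.exists_pair_ne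
  exact hxy (Subrepresentation.toSubmodule_injective (Subsingleton.elim _ _))

theorem Representation.IsIrreducible.eq_top {G V : Type*} [Group G] [AddCommGroup V]
    [Module ℂ V] {ρ : Representation ℂ G V} (h : ρ.IsIrreducible) {W : Submodule ℂ V}
    (hW : ∀ g, ∀ v ∈ W, ρ g v ∈ W) (h0 : W ≠ ⊥) : W = ⊤ := by
  rcases h.eq_bot_or_eq_top ⟨W, fun g v hv => hW g v hv⟩ with e | e
  · exact absurd (congrArg Subrepresentation.toSubmodule e) h0
  · exact congrArg Subrepresentation.toSubmodule e

theorem finprod_mem_eq_pow_ncard {α : Type*} {S : Set α} (hS : S.Finite) {f : α → ℂ} {c : ℂ}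
    (hf : ∀ x ∈ S, f x = c) : ∏ᶠ x ∈ S, f x = c ^ S.ncard := by
  rw [finprod_mem_congr rfl hf, finprod_mem_eq_finite_toFinset_prod _ hS, Finset.prod_const,
    Set.ncard_eq_toFinset_card S hS]

/-- Maps with the same fibres on `S` have images in bijection. This matches noncentral classes in
`⟨s⟩` with characters of degree 2 without counting either. -/
theorem ncard_image_eq_ncard_image {α β γ : Type*} {f : α → β} {g : α → γ} {S : Set α}
    (h : ∀ x ∈ S, ∀ y ∈ S, f x = f y ↔ g x = g y) : (f '' S).ncard = (g '' S).ncard := by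
  have key : ∀ b (hb : b ∈ f '' S), f hb.choose = b ∧ hb.choose ∈ S :=
    fun b hb => ⟨hb.choose_spec.2, hb.choose_spec.1⟩
  refine Set.ncard_congr (fun b hb => g hb.choose) ?_ ?_ ?_
  · exact fun b hb => ⟨_, (key b hb).2, rfl⟩
  · intro b c hb hc e
    rw [← (key b hb).1, ← (key c hc).1]
    exact (h _ (key b hb).2 _ (key c hc).2).2 e
  · rintro _ ⟨x, hx, rfl⟩
    have hb : f x ∈ f '' S := ⟨x, hx, rfl⟩
    exact ⟨f x, hb, (h _ (key _ hb).2 _ hx).1 (key _ hb).1⟩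

/-! ### Normal forms `s ^ k` and `t * s ^ k` -/

namespace IsSemidihedralPair

variable {a : ℕ} {G : Type} [Group G] {s t : G}

theorem t_mul_t (h : IsSemidihedralPair a s t) : t * t = 1 := by
  rw [← sq, h.sq_t]

theorem t_inv (h : IsSemidihedralPair a s t) : t⁻¹ = t :=
  inv_eq_of_mul_eq_one_left h.t_mul_t

theorem zpow_eq_zpow (h : IsSemidihedralPair a s t) {k l : ℤ} (hkl : (8 * a : ℤ) ∣ k - l) :
    s ^ k = s ^ l := by
  obtain ⟨m, hm⟩ := hkl
  rw [show k = l + 8 * a * m by linarith, zpow_add, zpow_mul, h.pow_s, one_zpow, mul_one]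

theorem conj_zpow (h : IsSemidihedralPair a s t) (k : ℤ) :
    t⁻¹ * s ^ k * t = s ^ ((4 * a - 1) * k : ℤ) := by
  have := _root_.conj_zpow (a := t⁻¹) (b := s) (i := k)
  rw [inv_inv] at this
  rw [← this, h.conj_s, zpow_mul]

theorem zpow_mul_t (h : IsSemidihedralPair a s t) (k : ℤ) :
    s ^ k * t = t * s ^ ((4 * a - 1) * k : ℤ) := by
  rw [← h.conj_zpow]; group

theorem eq_zpow_or (h : IsSemidihedralPair a s t) (g : G) :
    ∃ k : ℤ, g = s ^ k ∨ g = t * s ^ k := by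
  let H : Subgroup G :=
    { carrier := {g | ∃ k : ℤ, g = s ^ k ∨ g = t * s ^ k}
      one_mem' := ⟨0, by simp⟩
      mul_mem' := by
        rintro _ _ ⟨k, rfl | rfl⟩ ⟨l, rfl | rfl⟩
        · exact ⟨k + l, Or.inl (zpow_add _ _ _).symm⟩
        · refine ⟨(4 * a - 1) * k + l, Or.inr ?_⟩
          rw [← mul_assoc, h.zpow_mul_t, mul_assoc, zpow_add]
        · exact ⟨k + l, Or.inr (by rw [zpow_add, mul_assoc])⟩
        · refine ⟨(4 * a - 1) * k + l, Or.inl ?_⟩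
          rw [mul_assoc, ← mul_assoc (s ^ k), h.zpow_mul_t, mul_assoc, ← mul_assoc, h.t_mul_t,
            one_mul, zpow_add]
      inv_mem' := by
        rintro _ ⟨k, rfl | rfl⟩
        · exact ⟨-k, Or.inl (zpow_neg _ _).symm⟩
        · refine ⟨(4 * a - 1) * -k, Or.inr ?_⟩
          rw [mul_inv_rev, h.t_inv, ← zpow_neg, h.zpow_mul_t] }
  exact h.mem_of_mem H ⟨1, by simp⟩ ⟨0, by simp⟩ g

theorem eq_pow_or (h : IsSemidihedralPair a s t) (ha : 0 < a) (g : G) :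
    ∃ k : ℕ, g = s ^ k ∨ g = t * s ^ k := by
  obtain ⟨k, hk⟩ := h.eq_zpow_or g
  have h0 : 0 ≤ k % (8 * a) := Int.emod_nonneg _ (by omega)
  have e : s ^ k = s ^ (k % (8 * a)).toNat := by
    rw [← zpow_natCast, Int.toNat_of_nonneg h0]
    exact h.zpow_eq_zpow (Int.dvd_self_sub_emod)
  exact ⟨(k % (8 * a)).toNat, by rwa [← e]⟩

/-! ### Two-dimensional matrix representations -/

section Matrix

variable {ζ : ℂˣ}

/-- By universality only the relations need checking; the swap relation holds because `(4a - 1) ^ 2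
≡ 1` mod `8a`. -/
theorem exists_matrixHom (h : IsSemidihedralPair a s t) (hζ : ζ ^ (8 * a) = 1) (k : ℤ) :
    ∃ f : G →* (Matrix (Fin 2) (Fin 2) ℂ)ˣ,
      f s = diagonalUnits (ζ ^ k, ζ ^ ((4 * a - 1) * k : ℤ)) ∧ f t = swapUnit := by
  have hz : ∀ l m : ℤ, (8 * a : ℤ) ∣ l - m → ζ ^ l = ζ ^ m := by
    rintro l m ⟨c, hc⟩
    rw [show l = m + (8 * a : ℕ) * c by push_cast; linarith, zpow_add, zpow_mul, zpow_natCast, hζ,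
      one_zpow, mul_one]
  apply h.exists_lift
  · rw [← map_zpow, ← map_one diagonalUnits]
    congr 1
    ext1
    · simp only [Prod.pow_fst, Prod.fst_one, ← zpow_mul]
      rw [hz _ 0 ⟨k, by ring⟩, zpow_zero]
    · simp only [Prod.pow_snd, Prod.snd_one, ← zpow_mul]
      rw [hz _ 0 ⟨(4 * a - 1) * k, by ring⟩, zpow_zero]
  · ext1
    simp [swapUnit, sq, Matrix.one_fin_two]
  · rw [swapUnit_conj, ← map_zpow]
    congr 1
    ext1
    · simp only [Prod.pow_fst, ← zpow_mul]
      congr 1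
      ring
    · simp only [Prod.pow_snd, ← zpow_mul]
      apply hz
      obtain ⟨c, hc⟩ := dvd_sq_sub_one a
      exact ⟨-(c * k), by linear_combination -k * hc⟩

/-- The two-dimensional matrix representation of a semidihedral group in which `s` acts with
eigenvalues `ζ ^ k` and `ζ ^ ((4 * a - 1) * k)`. -/
noncomputable def matrixHom (h : IsSemidihedralPair a s t) (hζ : ζ ^ (8 * a) = 1) (k : ℤ) :
    G →* (Matrix (Fin 2) (Fin 2) ℂ)ˣ :=
  (h.exists_matrixHom hζ k).choose

theorem matrixHom_t (h : IsSemidihedralPair a s t) (hζ : ζ ^ (8 * a) = 1) (k : ℤ) :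
    h.matrixHom hζ k t = swapUnit :=
  (h.exists_matrixHom hζ k).choose_spec.2

theorem matrixHom_zpow (h : IsSemidihedralPair a s t) (hζ : ζ ^ (8 * a) = 1) (k j : ℤ) :
    h.matrixHom hζ k (s ^ j) =
      diagonalUnits ((ζ ^ k) ^ j, (ζ ^ ((4 * a - 1) * k : ℤ)) ^ j) := by
  rw [map_zpow, matrixHom, (h.exists_matrixHom hζ k).choose_spec.1, ← map_zpow]
  rfl

theorem matrixHom_s (h : IsSemidihedralPair a s t) (hζ : ζ ^ (8 * a) = 1) (k : ℤ) :
    h.matrixHom hζ k s = diagonalUnits (ζ ^ k, ζ ^ ((4 * a - 1) * k : ℤ)) :=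
  (h.exists_matrixHom hζ k).choose_spec.1

/-- The character of `matrixHom`. -/
noncomputable def matrixChar (h : IsSemidihedralPair a s t) (hζ : ζ ^ (8 * a) = 1) (k : ℤ) :
    G → ℂ :=
  fun g => (h.matrixHom hζ k g : Matrix (Fin 2) (Fin 2) ℂ).trace

theorem matrixChar_zpow (h : IsSemidihedralPair a s t) (hζ : ζ ^ (8 * a) = 1) (k j : ℤ) :
    h.matrixChar hζ k (s ^ j) =
      ((ζ ^ k : ℂˣ) : ℂ) ^ j + ((ζ ^ ((4 * a - 1) * k : ℤ) : ℂˣ) : ℂ) ^ j := by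
  rw [matrixChar, matrixHom_zpow]
  simp [diagonalUnits, Matrix.trace_fin_two]

theorem matrixChar_t_mul_zpow (h : IsSemidihedralPair a s t) (hζ : ζ ^ (8 * a) = 1) (k j : ℤ) :
    h.matrixChar hζ k (t * s ^ j) = 0 := by
  rw [matrixChar, map_mul, matrixHom_zpow, matrixHom_t]
  simp [diagonalUnits, swapUnit, Matrix.trace_fin_two]

theorem matrixChar_one (h : IsSemidihedralPair a s t) (hζ : ζ ^ (8 * a) = 1) (k : ℤ) :
    h.matrixChar hζ k 1 = 2 := by
  rw [← zpow_zero s, matrixChar_zpow]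
  norm_num

end Matrix

section Primitive

variable {ζ : ℂˣ}

theorem zpow_eq_zpow_iff_of_primitive (hζ : IsPrimitiveRoot ζ (8 * a)) {k l : ℤ} :
    ζ ^ k = ζ ^ l ↔ (8 * a : ℤ) ∣ k - l := by
  rw [← mul_inv_eq_one, ← zpow_neg, ← zpow_add, ← sub_eq_add_neg, hζ.zpow_eq_one_iff_dvd]
  push_cast
  rfl

theorem exists_isPrimitiveRoot_units (ha : 0 < a) : ∃ ζ : ℂˣ, IsPrimitiveRoot ζ (8 * a) :=
  ⟨_, (Complex.isPrimitiveRoot_exp (8 * a) (by omega)).isUnit_unit (by omega)⟩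

/-- The representation with `k = 1` and `ζ` primitive is faithful on `⟨s⟩`, so the relations do not
collapse the order of `s` below `8a`. -/
theorem zpow_eq_zpow_iff (h : IsSemidihedralPair a s t) (ha : 0 < a) {k l : ℤ} :
    s ^ k = s ^ l ↔ (8 * a : ℤ) ∣ k - l := by
  refine ⟨fun e => ?_, h.zpow_eq_zpow⟩
  obtain ⟨ζ, hζ⟩ := exists_isPrimitiveRoot_units ha
  have e' := congrArg (fun g => (h.matrixHom hζ.pow_eq_one 1 g : Matrix (Fin 2) (Fin 2) ℂ) 0 0) e
  simp only [matrixHom_zpow] at e'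
  rw [← zpow_eq_zpow_iff_of_primitive hζ]
  ext1
  simpa [diagonalUnits] using e'

theorem t_mul_zpow_ne (h : IsSemidihedralPair a s t) (ha : 0 < a) (k l : ℤ) :
    t * s ^ k ≠ s ^ l := by
  intro e
  obtain ⟨ζ, hζ⟩ := exists_isPrimitiveRoot_units ha
  have e' := congrArg (fun g => (h.matrixHom hζ.pow_eq_one 1 g : Matrix (Fin 2) (Fin 2) ℂ) 0 0) e
  simp only [map_mul, matrixHom_zpow, matrixHom_t] at e'
  simp [diagonalUnits, swapUnit] at e'
  exact zpow_ne_zero _ ζ.ne_zero e'.symm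

theorem dvd_iff_dvd_mul (a : ℕ) (k l : ℤ) :
    (8 * a : ℤ) ∣ l - (4 * a - 1) * k ↔ (8 * a : ℤ) ∣ k - (4 * a - 1) * l := by
  obtain ⟨c, hc⟩ := dvd_sq_sub_one a
  constructor
  · rintro ⟨d, hd⟩
    exact ⟨-(4 * a - 1) * d - c * k, by linear_combination -(4 * a - 1 : ℤ) * hd - k * hc⟩
  · rintro ⟨d, hd⟩
    exact ⟨-(4 * a - 1) * d - c * l, by linear_combination -(4 * a - 1 : ℤ) * hd - l * hc⟩

/-- The values at `s` and `s ^ 2` give the first two power sums of the eigenvalues of `s`, hence the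
unordered pair of eigenvalues. -/
theorem matrixChar_eq_iff (h : IsSemidihedralPair a s t) (hζ : IsPrimitiveRoot ζ (8 * a))
    {k l : ℤ} : h.matrixChar hζ.pow_eq_one k = h.matrixChar hζ.pow_eq_one l ↔
      (8 * a : ℤ) ∣ l - k ∨ (8 * a : ℤ) ∣ l - (4 * a - 1) * k := by
  constructor
  · intro e
    have e1 := congrFun e (s ^ (1 : ℤ))
    have e2 := congrFun e (s ^ (2 : ℤ))
    rw [matrixChar_zpow, matrixChar_zpow] at e1 e2
    simp only [zpow_ofNat] at e1 e2
    rw [← zpow_eq_zpow_iff_of_primitive hζ, ← zpow_eq_zpow_iff_of_primitive hζ, ← Units.val_inj,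
      ← Units.val_inj]
    generalize ((ζ ^ k : ℂˣ) : ℂ) = A at *
    generalize ((ζ ^ ((4 * a - 1) * k : ℤ) : ℂˣ) : ℂ) = A' at *
    generalize ((ζ ^ l : ℂˣ) : ℂ) = B at *
    generalize ((ζ ^ ((4 * a - 1) * l : ℤ) : ℂˣ) : ℂ) = B' at *
    have : (B - A) * (B - A') = 0 := by
      linear_combination (-B + (A + A' + B + B') / 2) * e1 - e2 / 2
    rcases mul_eq_zero.1 this with h0 | h0
    · exact Or.inl (sub_eq_zero.1 h0)
    · exact Or.inr (sub_eq_zero.1 h0)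
  · intro hd
    have key : ∀ j : ℤ, h.matrixChar hζ.pow_eq_one k (s ^ j) =
        h.matrixChar hζ.pow_eq_one l (s ^ j) := by
      intro j
      rw [matrixChar_zpow, matrixChar_zpow]
      rcases hd with hd | hd
      · have h1 := (zpow_eq_zpow_iff_of_primitive hζ).2 hd
        have h2 : ζ ^ ((4 * a - 1) * l : ℤ) = ζ ^ ((4 * a - 1) * k : ℤ) := by
          rw [mul_comm, zpow_mul, h1, ← zpow_mul, mul_comm]
        rw [h1, h2]
      · have h1 := (zpow_eq_zpow_iff_of_primitive hζ).2 hd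
        have h2 := (zpow_eq_zpow_iff_of_primitive hζ).2 ((dvd_iff_dvd_mul a k l).1 hd)
        rw [h1, h2, add_comm]
    funext g
    obtain ⟨j, rfl | rfl⟩ := h.eq_zpow_or g
    · exact key j
    · rw [matrixChar_t_mul_zpow, matrixChar_t_mul_zpow]

end Primitive

end IsSemidihedralPair

/-- The exponents `k` for which `s ^ k` is not central in the semidihedral group. -/
def noncentralExponents (a : ℕ) : Set ℤ := {k | ¬ (8 * a : ℤ) ∣ k - (4 * a - 1) * k}

namespace IsSemidihedralPair

variable {a : ℕ} {G : Type} [Group G] {s t : G}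

/-! ### Classification of the irreducible characters of degree different from 1 -/

section Representations

variable {ζ : ℂˣ}

/-- The representation on `ℂ ^ 2` given by `matrixHom`. -/
noncomputable def matrixRep (h : IsSemidihedralPair a s t) (hζ : ζ ^ (8 * a) = 1) (k : ℤ) :
    Representation ℂ G (Fin 2 → ℂ) :=
  (Matrix.toLinAlgEquiv' : Matrix (Fin 2) (Fin 2) ℂ ≃ₐ[ℂ] _).toMonoidHom.comp
    ((Units.coeHom _).comp (h.matrixHom hζ k))

theorem matrixRep_apply (h : IsSemidihedralPair a s t) (hζ : ζ ^ (8 * a) = 1) (k : ℤ) (g : G)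
    (v : Fin 2 → ℂ) : h.matrixRep hζ k g v =
      (h.matrixHom hζ k g : Matrix (Fin 2) (Fin 2) ℂ).mulVec v :=
  rfl

theorem character_matrixRep (h : IsSemidihedralPair a s t) (hζ : ζ ^ (8 * a) = 1) (k : ℤ) :
    (h.matrixRep hζ k).character = h.matrixChar hζ k := by
  funext g
  exact Matrix.trace_toLin'_eq _

theorem isIrreducible_matrixRep (h : IsSemidihedralPair a s t) (hζ : IsPrimitiveRoot ζ (8 * a))
    {k : ℤ} (hk : k ∈ noncentralExponents a) :
    (h.matrixRep hζ.pow_eq_one k).IsIrreducible := by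
  apply Subrepresentation.isSimpleOrder_of
  intro W hW hne
  obtain ⟨v, hv, hv0⟩ := W.ne_bot_iff.1 hne
  have hS : ∀ x y : ℂ, ![x, y] ∈ W → ![((ζ ^ k : ℂˣ) : ℂ) * x,
      ((ζ ^ ((4 * a - 1) * k : ℤ) : ℂˣ) : ℂ) * y] ∈ W := by
    intro x y hxy
    convert hW s _ hxy using 1
    rw [matrixRep_apply, matrixHom_s]
    ext i
    fin_cases i <;> simp [diagonalUnits, Matrix.mulVec, dotProduct]
  have hT : ∀ x y : ℂ, ![x, y] ∈ W → ![y, x] ∈ W := by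
    intro x y hxy
    convert hW t _ hxy using 1
    rw [matrixRep_apply, matrixHom_t]
    ext i
    fin_cases i <;> simp [swapUnit, Matrix.mulVec, dotProduct]
  have hne' : ((ζ ^ k : ℂˣ) : ℂ) - ((ζ ^ ((4 * a - 1) * k : ℤ) : ℂˣ) : ℂ) ≠ 0 := by
    rw [sub_ne_zero, Ne, Units.val_inj, zpow_eq_zpow_iff_of_primitive hζ]
    exact hk
  generalize ((ζ ^ k : ℂˣ) : ℂ) = A at *
  generalize ((ζ ^ ((4 * a - 1) * k : ℤ) : ℂˣ) : ℂ) = B at *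
  have h1 : ∀ x y : ℂ, ![x, y] ∈ W → x ≠ 0 → ![1, 0] ∈ W := by
    intro x y hxy hx
    -- `ρ s - B` kills the second coordinate and scales the first by `A - B ≠ 0`.
    have := W.smul_mem ((A - B)⁻¹ * x⁻¹) (W.sub_mem (hS x y hxy) (W.smul_mem B hxy))
    convert this using 1
    ext i
    fin_cases i
    · simp
      field_simp
    · simp
  have e : v = ![v 0, v 1] := by ext i; fin_cases i <;> rfl
  rw [e] at hv
  have h10 : ![1, 0] ∈ W := by
    by_cases h0 : v 0 = 0
    · refine h1 _ _ (hT _ _ hv) fun h1 => hv0 ?_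
      rw [e, h0, h1]
      simp
    · exact h1 _ _ hv h0
  have h01 := hT _ _ h10
  rw [eq_top_iff]
  intro w _
  have := W.add_mem (W.smul_mem (w 0) h10) (W.smul_mem (w 1) h01)
  convert this using 1
  ext i
  fin_cases i <;> simp

theorem apply_mem_of_generators (h : IsSemidihedralPair a s t) (ha : 0 < a) {V : Type*}
    [AddCommGroup V] [Module ℂ V] (ρ : Representation ℂ G V) (W : Submodule ℂ V)
    (hs : ∀ v ∈ W, ρ s v ∈ W) (ht : ∀ v ∈ W, ρ t v ∈ W) (g : G) : ∀ v ∈ W, ρ g v ∈ W := by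
  have hpow : ∀ k : ℕ, ∀ v ∈ W, ρ (s ^ k) v ∈ W := by
    intro k
    induction k with
    | zero => intro v hv; simpa using hv
    | succ k ih =>
      intro v hv
      rw [pow_succ, map_mul]
      exact ih _ (hs v hv)
  intro v hv
  obtain ⟨k, rfl | rfl⟩ := h.eq_pow_or ha g
  · exact hpow k v hv
  · rw [map_mul]
    exact ht _ (hpow k v hv)

theorem span_pair_mem {V : Type*} [AddCommGroup V] [Module ℂ V] {f : V →ₗ[ℂ] V} {v w : V}
    {W : Submodule ℂ V} (hv : f v ∈ W) (hw : f w ∈ W) :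
    ∀ x ∈ Submodule.span ℂ {v, w}, f x ∈ W := by
  intro x hx
  obtain ⟨α, β, rfl⟩ := Submodule.mem_span_pair.1 hx
  rw [map_add, map_smul, map_smul]
  exact W.add_mem (W.smul_mem _ hv) (W.smul_mem _ hw)

/-- For an eigenvector `v` of `s`, the span of `v` and `t v` is invariant, hence everything; in the
basis `v, t v` the generators act by the matrices of `matrixHom`. -/
theorem exists_matrixChar_eq (h : IsSemidihedralPair a s t) (ha : 0 < a)
    (hζ : IsPrimitiveRoot ζ (8 * a)) {d : ℕ} (ρ : Representation ℂ G (Fin d → ℂ))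
    (hρ : ρ.IsIrreducible) (hd : d ≠ 1) :
    ∃ k ∈ noncentralExponents a, ρ.character = h.matrixChar hζ.pow_eq_one k := by
  have := hρ.nontrivial
  have hd0 : d ≠ 0 := by
    rintro rfl
    exact not_subsingleton (Fin 0 → ℂ) inferInstance
  obtain ⟨x, hx⟩ := Module.End.exists_eigenvalue (ρ s)
  obtain ⟨v, hv⟩ := hx.exists_hasEigenvector
  have hsv : ρ s v = x • v := hv.apply_eq_smul
  have hpow : ∀ j : ℕ, ρ (s ^ j) v = x ^ j • v := by
    intro j
    induction j with
    | zero => simp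
    | succ j ih => rw [pow_succ', map_mul, Module.End.mul_apply, ih, map_smul, hsv, smul_smul,
        pow_succ]
  have hx1 : x ^ (8 * a) = 1 := by
    have h1 := hpow (8 * a)
    have h2 : s ^ (8 * a) = 1 := by
      rw [← h.pow_s, ← zpow_natCast]; push_cast; rfl
    rw [h2, map_one, Module.End.one_apply] at h1
    by_contra hne
    have h3 : (x ^ (8 * a) - 1) • v = 0 := by rw [sub_smul, one_smul, ← h1, sub_self]
    exact (smul_eq_zero.1 h3).elim (fun h => hne (sub_eq_zero.1 h)) hv.2
  obtain ⟨k, hk⟩ : ∃ k : ℤ, ((ζ ^ k : ℂˣ) : ℂ) = x := by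
    have : NeZero (8 * a) := ⟨by omega⟩
    obtain ⟨i, -, hi⟩ := (IsPrimitiveRoot.coe_units_iff.2 hζ).eq_pow_of_pow_eq_one hx1
    exact ⟨i, by simpa using hi⟩
  have hk' : ((ζ ^ ((4 * a - 1) * k : ℤ) : ℂˣ) : ℂ) = x ^ (4 * a - 1) := by
    rw [mul_comm, zpow_mul, Units.val_zpow_eq_zpow_val, hk, ← zpow_natCast]
    congr 1
    omega
  have htt : ∀ u, ρ t (ρ t u) = u := by
    intro u
    rw [← Module.End.mul_apply, ← map_mul, h.t_mul_t, map_one, Module.End.one_apply]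
  have hsw : ρ s (ρ t v) = x ^ (4 * a - 1) • ρ t v := by
    have e : s * t = t * s ^ (4 * a - 1) := by
      have := h.zpow_mul_t 1
      rw [zpow_one, mul_one] at this
      rw [this, ← zpow_natCast]
      congr 2
      omega
    rw [← Module.End.mul_apply, ← map_mul, e, map_mul, Module.End.mul_apply, hpow, map_smul]
  set w := ρ t v with hw
  have htw : ρ t w = v := htt v
  have hspan : Submodule.span ℂ {v, w} = ⊤ := by
    apply hρ.eq_top
    · have hvm : v ∈ Submodule.span ℂ {v, w} := Submodule.subset_span (by simp)
      have hwm : w ∈ Submodule.span ℂ {v, w} := Submodule.subset_span (by simp)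
      apply h.apply_mem_of_generators ha
      · apply span_pair_mem
        · rw [hsv]; exact Submodule.smul_mem _ _ hvm
        · rw [hsw]; exact Submodule.smul_mem _ _ hwm
      · apply span_pair_mem
        · exact hwm
        · rw [htt]; exact hvm
    · intro e
      exact hv.2 (Submodule.span_eq_bot.1 e v (by simp))
  have hspan' : Submodule.span ℂ (Set.range ![v, w]) = ⊤ := by
    rw [← hspan, Matrix.range_cons_cons_empty]
  have hfin : Module.finrank ℂ (Fin d → ℂ) = 2 := by
    have h1 := finrank_range_le_card (R := ℂ) ![v, w]
    rw [Set.finrank, hspan', finrank_top, Module.finrank_fin_fun, Fintype.card_fin] at h1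
    rw [Module.finrank_fin_fun]
    omega
  let b : Module.Basis (Fin 2) ℂ (Fin d → ℂ) :=
    basisOfTopLeSpanOfCardEqFinrank ![v, w] hspan'.ge (by rw [hfin, Fintype.card_fin])
  have hb : ⇑b = ![v, w] := coe_basisOfTopLeSpanOfCardEqFinrank _ _ _
  have hb0 : b 0 = v := by rw [hb]; rfl
  have hb1 : b 1 = w := by rw [hb]; rfl
  refine ⟨k, ?_, ?_⟩
  -- If the two eigenvalues agreed, `s` would be scalar and `v + w` would span an invariant line.
  · intro hdvd
    rw [← zpow_eq_zpow_iff_of_primitive hζ, ← Units.val_inj, hk, hk'] at hdvd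
    rw [← hdvd] at hsw
    have hvw : v + w ≠ 0 := by
      intro e
      have := congrArg (fun u => b.repr u 0) e
      simp only [← hb0, ← hb1, map_add] at this
      simp at this
    have htop : Submodule.span ℂ {v + w} = ⊤ := by
      apply hρ.eq_top
      · apply h.apply_mem_of_generators ha
        · intro u hu
          obtain ⟨α, rfl⟩ := Submodule.mem_span_singleton.1 hu
          rw [map_smul, map_add, hsv, hsw, ← smul_add]
          exact Submodule.smul_mem _ _ (Submodule.smul_mem _ _ (Submodule.mem_span_singleton_self _))
        · intro u hu
          obtain ⟨α, rfl⟩ := Submodule.mem_span_singleton.1 hu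
          rw [map_smul, map_add, ← hw, htt, add_comm w v]
          exact hu
      · rwa [Ne, Submodule.span_singleton_eq_bot]
    have := finrank_span_singleton (K := ℂ) hvw
    rw [htop, finrank_top, hfin] at this
    omega
  · have key : ((LinearMap.toMatrixAlgEquiv b).toMonoidHom.comp ρ : G →* _) =
        (Units.coeHom _).comp (h.matrixHom hζ.pow_eq_one k) := by
      ext1 g
      apply h.mem_of_mem (MonoidHom.eqLocus ((LinearMap.toMatrixAlgEquiv b).toMonoidHom.comp ρ)
        ((Units.coeHom _).comp (h.matrixHom hζ.pow_eq_one k)))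
      · change LinearMap.toMatrixAlgEquiv b (ρ s) = (h.matrixHom hζ.pow_eq_one k s).val
        rw [matrixHom_s]
        ext i j
        rw [LinearMap.toMatrixAlgEquiv_apply]
        fin_cases j
        · simp only [Fin.zero_eta, hb0, hsv, map_smul]
          rw [← hb0]
          fin_cases i <;> simp [diagonalUnits, ← hk]
        · simp only [Fin.mk_one, hb1, hsw, map_smul]
          rw [← hb1, ← hk']
          fin_cases i <;> simp [diagonalUnits]
      · change LinearMap.toMatrixAlgEquiv b (ρ t) = (h.matrixHom hζ.pow_eq_one k t).val
        rw [matrixHom_t]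
        ext i j
        rw [LinearMap.toMatrixAlgEquiv_apply]
        fin_cases j
        · simp only [Fin.zero_eta, hb0, ← hw]
          rw [← hb1]
          fin_cases i <;> simp [swapUnit]
        · simp only [Fin.mk_one, hb1, htw]
          rw [← hb0]
          fin_cases i <;> simp [swapUnit]
    funext g
    have := DFunLike.congr_fun key g
    change LinearMap.toMatrixAlgEquiv b (ρ g) = (h.matrixHom hζ.pow_eq_one k g).val at this
    rw [Representation.character, LinearMap.trace_eq_matrix_trace ℂ b, matrixChar, ← this]
    rfl

theorem finprod_irreducibleCharacters (h : IsSemidihedralPair a s t) (ha : 0 < a)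
    (hζ : IsPrimitiveRoot ζ (8 * a))
    (hfin : (h.matrixChar hζ.pow_eq_one '' noncentralExponents a).Finite) :
    ∏ᶠ χ ∈ irreducibleCharacters G, χ 1 =
      2 ^ (h.matrixChar hζ.pow_eq_one '' noncentralExponents a).ncard := by
  rw [← finprod_mem_eq_pow_ncard hfin (f := fun χ : G → ℂ => χ 1)]
  · apply finprod_mem_inter_mulSupport_eq'
    intro χ hχ
    constructor
    · rintro ⟨d, ρ, hρ, rfl⟩
      obtain ⟨k, hk, e⟩ := h.exists_matrixChar_eq ha hζ ρ hρ (by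
        -- Characters of degree 1 contribute a factor 1, so they lie outside the support of the
        -- product.
        rintro rfl
        apply hχ
        simp [Representation.character])
      exact ⟨k, hk, e.symm⟩
    · rintro ⟨k, hk, rfl⟩
      exact ⟨2, h.matrixRep hζ.pow_eq_one k, h.isIrreducible_matrixRep hζ hk,
        (h.character_matrixRep _ _).symm⟩
  · rintro _ ⟨k, -, rfl⟩
    exact h.matrixChar_one _ _

end Representations

/-! ### Conjugacy classes and their sizes -/

/-- The exponents run through one parity class mod `8a`. Used with `u = t` for conjugacy classes and
with `u = 1`, `e = 0` for the commutator subgroup. -/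
theorem ncard_mul_zpow (h : IsSemidihedralPair a s t) (ha : 0 < a) (u : G) (e : ℤ) :
    {g | ∃ i : ℤ, g = u * s ^ (e + 2 * i)}.ncard = 4 * a := by
  have : {g | ∃ i : ℤ, g = u * s ^ (e + 2 * i)} =
      (fun i : ℤ => u * s ^ (e + 2 * i)) '' (Finset.Ico (0 : ℤ) (4 * a) : Set ℤ) := by
    ext g
    constructor
    · rintro ⟨i, rfl⟩
      refine ⟨i % (4 * a), ?_, ?_⟩
      · simp only [Finset.coe_Ico, Set.mem_Ico]
        exact ⟨Int.emod_nonneg _ (by omega), Int.emod_lt_of_pos _ (by omega)⟩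
      · simp only [mul_right_inj]
        apply h.zpow_eq_zpow
        obtain ⟨c, hc⟩ := Int.dvd_self_sub_emod (x := i) (m := 4 * a)
        exact ⟨-c, by linear_combination -2 * hc⟩
    · rintro ⟨i, -, rfl⟩
      exact ⟨i, rfl⟩
  rw [this, Set.InjOn.ncard_image, Set.ncard_coe_finset, Int.card_Ico]
  · omega
  · intro i hi j hj hij
    simp only [mul_right_inj, h.zpow_eq_zpow_iff ha] at hij
    simp only [Finset.coe_Ico, Set.mem_Ico] at hi hj
    obtain ⟨c, hc⟩ := hij
    have h1 : i - j = 4 * a * c := by linarith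
    have h2 : c < 1 := by
      by_contra! hc1
      nlinarith
    have h3 : -1 < c := by
      by_contra! hc1
      nlinarith
    have : c = 0 := by omega
    subst this
    linarith

theorem isConj_zpow_iff (h : IsSemidihedralPair a s t) (k : ℤ) (g : G) :
    IsConj (s ^ k) g ↔ g = s ^ k ∨ g = s ^ ((4 * a - 1) * k : ℤ) := by
  rw [isConj_iff]
  constructor
  · rintro ⟨c, rfl⟩
    obtain ⟨j, rfl | rfl⟩ := h.eq_zpow_or c
    · left; group
    · right
      rw [← h.conj_zpow, h.t_inv, mul_inv_rev, h.t_inv]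
      group
  · rintro (rfl | rfl)
    · exact ⟨1, by simp⟩
    · exact ⟨t⁻¹, by rw [inv_inv, h.conj_zpow]⟩

theorem isConj_t_mul_zpow_iff (h : IsSemidihedralPair a s t) (e : ℤ) (g : G) :
    IsConj (t * s ^ e) g ↔ ∃ i : ℤ, g = t * s ^ (e + 2 * i) := by
  have hs : ∀ j k : ℤ, s ^ j * (t * s ^ k) * (s ^ j)⁻¹ = t * s ^ (k + 2 * ((2 * a - 1) * j)) := by
    intro j k
    rw [← mul_assoc, h.zpow_mul_t, ← zpow_neg, mul_assoc, mul_assoc, ← zpow_add, ← zpow_add]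
    congr 2
    ring
  have ht : ∀ k : ℤ, t * (t * s ^ k) * t⁻¹ = t * s ^ (k + 2 * ((2 * a - 1) * k)) := by
    intro k
    rw [← mul_assoc, h.t_mul_t, one_mul, h.t_inv, h.zpow_mul_t]
    congr 2
    ring
  rw [isConj_iff]
  constructor
  · rintro ⟨c, rfl⟩
    obtain ⟨j, rfl | rfl⟩ := h.eq_zpow_or c
    · exact ⟨_, hs j e⟩
    · refine ⟨(2 * a - 1) * j + (2 * a - 1) * (e + 2 * ((2 * a - 1) * j)), ?_⟩
      rw [mul_inv_rev, show t * s ^ j * (t * s ^ e) * ((s ^ j)⁻¹ * t⁻¹) =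
        t * (s ^ j * (t * s ^ e) * (s ^ j)⁻¹) * t⁻¹ by group, hs, ht]
      congr 2
      ring
  · rintro ⟨i, rfl⟩
    -- Conjugation by `s ^ j` shifts the exponent by `2 (2a - 1) j`, and `-(2a + 1)` is the inverse
    -- of `2a - 1` mod `4a`.
    refine ⟨s ^ (-(2 * a + 1) * i), ?_⟩
    rw [hs]
    congr 1
    exact h.zpow_eq_zpow ⟨-(a * i), by ring⟩

theorem card_carrier_zpow (h : IsSemidihedralPair a s t) (ha : 0 < a) (k : ℤ)
    [Decidable (k ∈ noncentralExponents a)] :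
    Nat.card (ConjClasses.mk (s ^ k)).carrier = if k ∈ noncentralExponents a then 2 else 1 := by
  have e : (ConjClasses.mk (s ^ k)).carrier = {s ^ k, s ^ ((4 * a - 1) * k : ℤ)} := by
    ext g
    rw [ConjClasses.mem_carrier_iff_mk_eq, ConjClasses.mk_eq_mk_iff_isConj, isConj_comm,
      h.isConj_zpow_iff]
    rfl
  rw [e, Nat.card_coe_set_eq]
  split_ifs with hk
  · exact Set.ncard_pair fun e => hk ((h.zpow_eq_zpow_iff ha).1 e)
  · replace hk : (8 * a : ℤ) ∣ k - (4 * a - 1) * k := not_not.1 hk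
    rw [h.zpow_eq_zpow hk, Set.pair_eq_singleton, Set.ncard_singleton]

theorem card_carrier_t_mul_zpow (h : IsSemidihedralPair a s t) (ha : 0 < a) (e : ℤ) :
    Nat.card (ConjClasses.mk (t * s ^ e)).carrier = 4 * a := by
  rw [← h.ncard_mul_zpow ha t e, Nat.card_coe_set_eq]
  congr 1
  ext g
  rw [ConjClasses.mem_carrier_iff_mk_eq, ConjClasses.mk_eq_mk_iff_isConj, isConj_comm,
    h.isConj_t_mul_zpow_iff]
  rfl

theorem mk_zpow_eq_iff (h : IsSemidihedralPair a s t) (ha : 0 < a) (k l : ℤ) :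
    ConjClasses.mk (s ^ k) = ConjClasses.mk (s ^ l) ↔
      (8 * a : ℤ) ∣ l - k ∨ (8 * a : ℤ) ∣ l - (4 * a - 1) * k := by
  rw [ConjClasses.mk_eq_mk_iff_isConj, h.isConj_zpow_iff, h.zpow_eq_zpow_iff ha,
    h.zpow_eq_zpow_iff ha]

theorem finite (h : IsSemidihedralPair a s t) (ha : 0 < a) : Finite G := by
  have hs : (Set.range fun k : ℤ => s ^ k).Finite := by
    refine ((Set.finite_Ico (0 : ℤ) (8 * a)).image fun k : ℤ => s ^ k).subset ?_
    rintro _ ⟨k, rfl⟩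
    exact ⟨k % (8 * a), ⟨Int.emod_nonneg _ (by omega), Int.emod_lt_of_pos _ (by omega)⟩,
      (h.zpow_eq_zpow Int.dvd_self_sub_emod).symm⟩
  rw [← Set.finite_univ_iff]
  refine (hs.union (hs.image fun g => t * g)).subset fun g _ => ?_
  obtain ⟨k, rfl | rfl⟩ := h.eq_zpow_or g
  · exact Or.inl ⟨k, rfl⟩
  · exact Or.inr ⟨_, ⟨k, rfl⟩, rfl⟩

theorem finprod_card_carrier (h : IsSemidihedralPair a s t) (ha : 0 < a) :
    ∏ᶠ K : ConjClasses G, (Nat.card K.carrier : ℂ) = (4 * a) ^ 2 *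
      2 ^ ((fun k : ℤ => ConjClasses.mk (s ^ k)) '' noncentralExponents a).ncard := by
  classical
  have := h.finite ha
  have hfin : ∀ S : Set (ConjClasses G), S.Finite := fun S => S.toFinite
  have hne : ConjClasses.mk (t * s ^ (0 : ℤ)) ≠ ConjClasses.mk (t * s ^ (1 : ℤ)) := by
    rw [Ne, ConjClasses.mk_eq_mk_iff_isConj, h.isConj_t_mul_zpow_iff]
    rintro ⟨i, hi⟩
    rw [mul_right_inj, h.zpow_eq_zpow_iff ha] at hi
    obtain ⟨c, hc⟩ := hi
    have : (1 : ℤ) = 2 * (4 * (a * c) + i) := by linarith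
    omega
  have hdisj : Disjoint {ConjClasses.mk (t * s ^ (0 : ℤ)), ConjClasses.mk (t * s ^ (1 : ℤ))}
      ((fun k : ℤ => ConjClasses.mk (s ^ k)) '' noncentralExponents a) := by
    have key : ∀ k e : ℤ, ConjClasses.mk (s ^ k) ≠ ConjClasses.mk (t * s ^ e) := by
      intro k e hke
      rw [ConjClasses.mk_eq_mk_iff_isConj, h.isConj_zpow_iff] at hke
      rcases hke with hke | hke <;> exact h.t_mul_zpow_ne ha _ _ hke
    rw [Set.disjoint_right]
    rintro _ ⟨k, -, rfl⟩ (hk | hk)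
    · exact key _ _ hk
    · exact key _ _ hk
  rw [← finprod_mem_eq_pow_ncard (hfin _)
      (f := fun K : ConjClasses G => (Nat.card K.carrier : ℂ)),
    sq, ← Nat.cast_ofNat, ← Nat.cast_mul]
  -- Each factor `4a` becomes the size of a class outside `⟨s⟩`; the only classes then missing are
  -- central and contribute 1.
  · nth_rewrite 1 [← h.card_carrier_t_mul_zpow ha 0]
    rw [← h.card_carrier_t_mul_zpow ha 1,
      ← finprod_mem_pair (f := fun K : ConjClasses G => (Nat.card K.carrier : ℂ)) hne,
      ← finprod_mem_union hdisj (hfin _) (hfin _), ← finprod_mem_univ]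
    apply finprod_mem_inter_mulSupport_eq'
    intro K hK
    refine ⟨fun _ => ?_, fun _ => trivial⟩
    obtain ⟨g, rfl⟩ := ConjClasses.mk_surjective K
    obtain ⟨k, rfl | rfl⟩ := h.eq_zpow_or g
    · right
      refine ⟨k, ?_, rfl⟩
      by_contra hk
      apply hK
      simp only [h.card_carrier_zpow ha, if_neg hk, Nat.cast_one]
    · left
      obtain ⟨j, hj | hj⟩ := k.even_or_odd'
      · left
        rw [eq_comm, ConjClasses.mk_eq_mk_iff_isConj, h.isConj_t_mul_zpow_iff]
        exact ⟨j, by rw [hj, zero_add]⟩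
      · right
        rw [Set.mem_singleton_iff, eq_comm, ConjClasses.mk_eq_mk_iff_isConj,
          h.isConj_t_mul_zpow_iff]
        exact ⟨j, by rw [hj, add_comm]⟩
  · rintro _ ⟨k, hk, rfl⟩
    simp only [h.card_carrier_zpow ha, if_pos hk, Nat.cast_ofNat]

/-! ### Commutator subgroup and Harada's number -/

theorem mem_commutator_iff (h : IsSemidihedralPair a s t) (g : G) :
    g ∈ commutator G ↔ ∃ i : ℤ, g = 1 * s ^ (0 + 2 * i) := by
  simp only [one_mul, zero_add]
  constructor
  · intro hg
    -- This abelian quotient detects the parity of the exponent of `s` and the presence of `t`.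
    obtain ⟨f, hfs, hft⟩ := h.exists_lift (M := ℤˣ × ℤˣ) (-1, 1) (1, -1)
      (by ext1 <;> simp [show (8 * a : ℤ) = 2 * (4 * a) by ring, zpow_mul])
      (by ext1 <;> simp)
      (by
        ext1
        · have : (4 * a - 1 : ℤ) = 2 * (2 * a) - 1 := by ring
          simp [this, zpow_sub, zpow_mul]
        · simp)
    have hf := Abelianization.commutator_subset_ker f hg
    rw [MonoidHom.mem_ker] at hf
    obtain ⟨k, rfl | rfl⟩ := h.eq_zpow_or g
    · rw [map_zpow, hfs] at hf
      obtain ⟨j, hj | hj⟩ := k.even_or_odd'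
      · exact ⟨j, by rw [hj]⟩
      · have := congrArg Prod.fst hf
        rw [hj] at this
        simp [zpow_add, zpow_mul] at this
    · rw [map_mul, map_zpow, hfs, hft] at hf
      have := congrArg Prod.snd hf
      simp at this
  · rintro ⟨i, rfl⟩
    have hc : s ^ (4 * a - 2 : ℤ) ∈ commutator G := by
      have := Subgroup.commutator_mem_commutator (Subgroup.mem_top (s⁻¹))
        (Subgroup.mem_top (t⁻¹))
      rwa [commutatorElement_def, inv_inv, inv_inv, mul_assoc, mul_assoc, ← mul_assoc t⁻¹,
        h.conj_s, ← zpow_neg_one, ← zpow_add,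
        show (-1 + (4 * a - 1) : ℤ) = 4 * a - 2 by ring] at this
    -- The same inverse of `2a - 1` mod `4a` recovers every even power from `s ^ (4a - 2)`.
    have := (commutator G).zpow_mem hc (-(2 * a + 1) * i)
    rw [← zpow_mul] at this
    convert this using 1
    exact h.zpow_eq_zpow ⟨a * i, by ring⟩

theorem card_commutator (h : IsSemidihedralPair a s t) (ha : 0 < a) :
    Nat.card (commutator G) = 4 * a := by
  rw [← h.ncard_mul_zpow ha 1 0, ← Nat.card_coe_set_eq]
  congr 2
  ext g
  exact h.mem_commutator_iff g

theorem haradaNumber_eq (h : IsSemidihedralPair a s t) (ha : 0 < a) :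
    haradaNumber G = (4 * a) ^ 2 := by
  obtain ⟨ζ, hζ⟩ := exists_isPrimitiveRoot_units ha
  have := h.finite ha
  have hiff : ∀ k ∈ noncentralExponents a, ∀ l ∈ noncentralExponents a,
      ConjClasses.mk (s ^ k) = ConjClasses.mk (s ^ l) ↔
        h.matrixChar hζ.pow_eq_one k = h.matrixChar hζ.pow_eq_one l := fun k _ l _ => by
    rw [h.mk_zpow_eq_iff ha, h.matrixChar_eq_iff hζ]
  have hcard := ncard_image_eq_ncard_image hiff
  have hfin : (h.matrixChar hζ.pow_eq_one '' noncentralExponents a).Finite := by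
    -- A positive `ncard` forces finiteness; the set is nonempty on the class side since `s` is not
    -- central.
    apply Set.finite_of_ncard_pos
    rw [← hcard, Set.ncard_pos]
    refine ⟨_, 1, ?_, rfl⟩
    rintro ⟨c, hc⟩
    have : (1 : ℤ) = 2 * (2 * (a * c) + a) := by linarith
    omega
  rw [haradaNumber, h.finprod_card_carrier ha, h.finprod_irreducibleCharacters ha hζ hfin, hcard,
    mul_div_assoc, div_self (pow_ne_zero _ two_ne_zero), mul_one]

end IsSemidihedralPair

/-! ### The presented group -/

namespace SemidihedralGroup

theorem isSemidihedralPair (b : ℕ) :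
    IsSemidihedralPair (2 ^ b) (PresentedGroup.of Gen.σ : SemidihedralGroup (4 + b))
      (PresentedGroup.of Gen.τ) := by
  have e1 : 2 ^ (4 + b - 1) = 8 * 2 ^ b := by
    rw [show 4 + b - 1 = 3 + b by omega, pow_add]; norm_num
  have e2 : 2 ^ (4 + b - 2) = 4 * 2 ^ b := by
    rw [show 4 + b - 2 = 2 + b by omega, pow_add]; norm_num
  -- The relator uses truncated subtraction, which agrees with integer subtraction because `2 ^ b >
  -- 0`.
  have e3 : ((4 * (2 ^ b : ℕ) - 1 : ℤ)) = ((4 * 2 ^ b - 1 : ℕ) : ℤ) := by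
    have : 0 < 2 ^ b := by positivity
    omega
  have hrel : ∀ r ∈ rels (4 + b), PresentedGroup.mk (rels (4 + b)) r = 1 :=
    fun r hr => PresentedGroup.one_of_mem hr
  simp only [rels, e1, e2, Set.mem_insert_iff, Set.mem_singleton_iff, forall_eq_or_imp, forall_eq] at hrel
  constructor
  · exact_mod_cast hrel.1
  · exact hrel.2.1
  · rw [e3, zpow_natCast]
    exact mul_inv_eq_one.1 hrel.2.2
  · intro H hs ht g
    exact PresentedGroup.generated_by _ H (fun j => by cases j <;> assumption) g
  · intro M _ x y hx hy hxy
    let f : Gen → M := fun j => match j with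
      | Gen.σ => x
      | Gen.τ => y
    have hf : ∀ r ∈ rels (4 + b), FreeGroup.lift f r = 1 := by
      simp only [rels, e1, e2, Set.mem_insert_iff, Set.mem_singleton_iff, forall_eq_or_imp,
        forall_eq, map_mul, map_pow, map_inv, s, t, FreeGroup.lift_apply_of, f]
      rw [e3, zpow_natCast] at hxy
      exact ⟨by exact_mod_cast hx, hy, mul_inv_eq_one.2 hxy⟩
    exact ⟨PresentedGroup.toGroup hf, PresentedGroup.toGroup.of hf, PresentedGroup.toGroup.of hf⟩

end SemidihedralGroup

theorem mainTheorem11 (n : ℕ) (hn : 4 ≤ n) :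
    haradaNumber (SemidihedralGroup n) = 2 ^ (2 * (n - 2)) ∧
      (2 : ℂ) ^ (2 * (n - 2)) = (Nat.card (commutator (SemidihedralGroup n)) : ℂ) ^ 2 := by
  obtain ⟨b, rfl⟩ := Nat.exists_eq_add_of_le hn
  have h := SemidihedralGroup.isSemidihedralPair b
  have ha : 0 < 2 ^ b := by positivity
  have e : (2 : ℂ) ^ (2 * (4 + b - 2)) = (4 * (2 ^ b : ℕ)) ^ 2 := by
    rw [show 2 * (4 + b - 2) = (2 + b) * 2 by omega, pow_mul, pow_add]
    norm_num
  rw [h.haradaNumber_eq ha, h.card_commutator ha, e]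
  push_cast
  exact ⟨rfl, rfl⟩
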